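/- Let the Euler polynomials $E_n(x)$, $n\ge 0$, be defined by the generating function $$\frac{2e^{xt}}{e^t+1}=\sum_{n=0}^\infty E_n(x)\frac{t^n}{n!},$$ and for a sequence $(c_k)_{k\ge 0}$ let $H_n(c_k)=\det\big(c_{i+j}\big)_{0\le i,j\le n}$ denote its $n$-th Hankel determinant (of size $n+1$). Let the sequence $(b_k)_{k\ge 0}$ be defined by $b_0=0$ and $b_k=E_{2k-1}(1)/(2k-1)!$ for $k\ge 1$. Then for all $n\ge 1$, $$H_n(b_k)=(-1)^n\,\frac{(4n+2)!}{(2n-1)!}\cdot H_n\!\left(\frac{E_{2k+1}(1)}{(2k+1)!}\right).$$ -/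

import Mathlib

open scoped Nat Polynomial

/-- The `n`-th Euler polynomial `E_n(x)`, defined by the generating function
`2 e^{xt} / (e^t + 1) = ∑ E_n(x) t^n / n!`, read as an identity of formal power series in `t`
over `ℚ[x]`: it is `n!` times the coefficient of `t^n` in the left-hand side. (The series
`e^t + 1` has constant term `2`, so it is invertible over `ℚ`.) -/
noncomputable def eulerPolynomial (n : ℕ) : ℚ[X] :=
  (n ! : ℚ[X]) * PowerSeries.coeff n
    (2 * PowerSeries.rescale (Polynomial.X : ℚ[X]) (PowerSeries.exp ℚ[X]) *
      PowerSeries.map Polynomial.C (PowerSeries.exp ℚ + 1)⁻¹)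

/-- The Hankel determinant `H_n(c) = det (c_{i+j})_{0 ≤ i, j ≤ n}`, of size `n + 1`. -/
def hankelDet {R : Type*} [CommRing R] (n : ℕ) (c : ℕ → R) : R :=
  (Matrix.of fun i j : Fin (n + 1) => c ((i : ℕ) + (j : ℕ))).det

/-! With b and c the two sequences, c_k = b_{k+1}, so the Hankel matrices share n columns, and it
suffices to write the first column of b's matrix in the columns of c's; only the coefficient of the
last column affects the determinant. Let F = 2e^t/(e^t+1), and let B combine two consecutive
diagonal Padé numerators of e^t, so B(-t)e^t ≡ B(t) mod t^(4n+3). The even part P of B then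
satisfies PF ≡ B. The odd coefficients of B from degree 2n+1 on vanish, which gives the column
relation (`sum_mixedPadeCoeff_mul_hankel`); the factor is B(0). -/

/-- The generating series `2 e^t / (e^t + 1)` of the numbers `E_n(1) / n!`. -/
noncomputable def eulerSeriesOne : PowerSeries ℚ :=
  2 * PowerSeries.exp ℚ * (PowerSeries.exp ℚ + 1)⁻¹

theorem constantCoeff_exp_add_one_ne_zero :
    PowerSeries.constantCoeff (PowerSeries.exp ℚ + 1) ≠ 0 := by
  simp only [map_add, PowerSeries.constantCoeff_exp, map_one]
  norm_num

theorem eulerSeriesOne_mul_exp_add_one :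
    (PowerSeries.exp ℚ + 1) * eulerSeriesOne = 2 * PowerSeries.exp ℚ := by
  rw [eulerSeriesOne, mul_left_comm,
    PowerSeries.mul_inv_cancel _ constantCoeff_exp_add_one_ne_zero, mul_one]

theorem eval_one_eulerPolynomial_div_factorial (n : ℕ) :
    (eulerPolynomial n).eval 1 / (n ! : ℚ) = PowerSeries.coeff n eulerSeriesOne := by
  have hmap : PowerSeries.map (Polynomial.evalRingHom (1 : ℚ))
      (2 * PowerSeries.rescale (Polynomial.X : ℚ[X]) (PowerSeries.exp ℚ[X]) *
        PowerSeries.map Polynomial.C (PowerSeries.exp ℚ + 1)⁻¹) = eulerSeriesOne := by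
    rw [map_mul, map_mul, eulerSeriesOne]
    congr 1
    · congr 1
      · exact map_ofNat _ 2
      · ext k
        simp [PowerSeries.coeff_rescale, PowerSeries.coeff_exp, Polynomial.algebraMap_eq]
    · ext k
      simp
  have hcoeff := congrArg (PowerSeries.coeff n) hmap
  rw [PowerSeries.coeff_map, Polynomial.coe_evalRingHom] at hcoeff
  have hn : (n ! : ℚ) ≠ 0 := by exact_mod_cast n.factorial_ne_zero
  rw [eulerPolynomial, Polynomial.eval_mul, hcoeff, Polynomial.eval_natCast,
    mul_div_cancel_left₀ _ hn]

/-- Compare coefficients of X^m in (X+1)^M X^N, expanding X^N = ((X+1)-1)^N. -/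
theorem sum_neg_one_pow_choose_mul_choose (M N m : ℕ) :
    ∑ k ∈ Finset.range (N + 1), (-1 : ℚ) ^ k * N.choose k * (M + N - k).choose m =
      if N ≤ m then (M.choose (m - N) : ℚ) else 0 := by
  have key : (∑ k ∈ Finset.range (N + 1),
      Polynomial.C ((-1 : ℚ) ^ k * N.choose k) * (Polynomial.X + 1) ^ (M + N - k)) =
      (Polynomial.X + 1) ^ M * Polynomial.X ^ N := by
    have h : (Polynomial.X : ℚ[X]) ^ N = (-1 + (Polynomial.X + 1)) ^ N := by ring
    rw [h, add_pow (-1 : ℚ[X]), Finset.mul_sum]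
    refine Finset.sum_congr rfl fun k hk => ?_
    have hk' : k ≤ N := Nat.lt_succ_iff.mp (Finset.mem_range.mp hk)
    rw [Nat.add_sub_assoc hk', pow_add]
    simp only [map_mul, map_pow, map_neg, map_one, map_natCast]
    ring
  have := congrArg (fun p => Polynomial.coeff p m) key
  simp only [Polynomial.finsetSum_coeff, Polynomial.coeff_C_mul, Polynomial.coeff_X_add_one_pow,
    Polynomial.coeff_mul_X_pow'] at this
  exact this

/-- The coefficients `(2m-k)! / (k! (m-k)!)` of the numerator of the diagonal Padé approximant of
order `m` of the exponential function. They vanish for `k > m > 0`. -/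
def expPadeCoeff (m k : ℕ) : ℚ := (m ! : ℚ) / k ! * (2 * m - k).choose m

/-- The Padé property Q(-t)e^t ≡ Q(t) mod t^(2m+1), coefficientwise. -/
theorem sum_neg_one_pow_mul_expPadeCoeff {m N : ℕ} (hN : N ≤ 2 * m) :
    ∑ k ∈ Finset.range (N + 1), (-1 : ℚ) ^ k * expPadeCoeff m k * (1 / (N - k)!) =
      expPadeCoeff m N := by
  have hsum := sum_neg_one_pow_choose_mul_choose (2 * m - N) N m
  rw [Nat.sub_add_cancel hN] at hsum
  have hval : (if N ≤ m then ((2 * m - N).choose (m - N) : ℚ) else 0) =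
      (2 * m - N).choose m := by
    split_ifs with h
    · rw [← Nat.choose_symm_of_eq_add (show 2 * m - N = m + (m - N) by omega)]
    · rw [Nat.choose_eq_zero_of_lt (by omega), Nat.cast_zero]
  rw [expPadeCoeff, ← hval, ← hsum, Finset.mul_sum]
  refine Finset.sum_congr rfl fun k hk => ?_
  have hk' : k ≤ N := Nat.lt_succ_iff.mp (Finset.mem_range.mp hk)
  have h₁ : (N ! : ℚ) ≠ 0 := by exact_mod_cast N.factorial_ne_zero
  have h₂ : (k ! : ℚ) ≠ 0 := by exact_mod_cast k.factorial_ne_zero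
  have h₃ : ((N - k)! : ℚ) ≠ 0 := by exact_mod_cast (N - k).factorial_ne_zero
  rw [expPadeCoeff, Nat.cast_choose ℚ hk']
  field_simp

/-- The combination of two consecutive Padé numerators, of orders `2n+1` and `2n+2`, whose
coefficient in degree `2n+1` vanishes. -/
def mixedPadeCoeff (n k : ℕ) : ℚ :=
  (2 * n + 2) * (2 * n + 3) * expPadeCoeff (2 * n + 1) k - expPadeCoeff (2 * n + 2) k

theorem expPadeCoeff_of_lt {m k : ℕ} (hm : 0 < m) (hk : m < k) : expPadeCoeff m k = 0 := by
  rw [expPadeCoeff, Nat.choose_eq_zero_of_lt (by omega), Nat.cast_zero, mul_zero]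

theorem expPadeCoeff_self (m : ℕ) : expPadeCoeff m m = 1 := by
  have h : (m ! : ℚ) ≠ 0 := by exact_mod_cast m.factorial_ne_zero
  rw [expPadeCoeff, show 2 * m - m = m by omega, Nat.choose_self, Nat.cast_one, mul_one,
    div_self h]

theorem mixedPadeCoeff_of_lt {n k : ℕ} (hk : 2 * n + 2 < k) : mixedPadeCoeff n k = 0 := by
  rw [mixedPadeCoeff, expPadeCoeff_of_lt (by omega) (by omega),
    expPadeCoeff_of_lt (by omega) hk]
  ring

theorem mixedPadeCoeff_two_mul_add_two (n : ℕ) : mixedPadeCoeff n (2 * n + 2) = -1 := by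
  rw [mixedPadeCoeff, expPadeCoeff_of_lt (by omega) (by omega), expPadeCoeff_self]
  ring

theorem mixedPadeCoeff_two_mul_add_one (n : ℕ) : mixedPadeCoeff n (2 * n + 1) = 0 := by
  have h : ((2 * n + 1)! : ℚ) ≠ 0 := by exact_mod_cast (2 * n + 1).factorial_ne_zero
  rw [mixedPadeCoeff, expPadeCoeff_self, expPadeCoeff,
    show 2 * (2 * n + 2) - (2 * n + 1) = (2 * n + 2) + 1 by omega, Nat.choose_succ_self_right,
    Nat.factorial_succ (2 * n + 1)]
  push_cast
  field_simp
  ring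

theorem mixedPadeCoeff_zero {n : ℕ} (hn : 1 ≤ n) :
    mixedPadeCoeff n 0 = ((4 * n + 2)! : ℚ) / (2 * n - 1)! := by
  obtain ⟨l, rfl⟩ : ∃ l, n = l + 1 := ⟨n - 1, by omega⟩
  have h₁ : ((2 * l + 1)! : ℚ) ≠ 0 := by exact_mod_cast (2 * l + 1).factorial_ne_zero
  have h₂ : ((4 * l + 6)! : ℚ) ≠ 0 := by exact_mod_cast (4 * l + 6).factorial_ne_zero
  have e₁ : 2 * (l + 1) - 1 = 2 * l + 1 := by omega
  have e₂ : 4 * (l + 1) + 2 = 4 * l + 6 := by omega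
  have e₃ : 2 * (2 * (l + 1) + 1) - 0 = 4 * l + 6 := by omega
  have e₄ : 2 * (2 * (l + 1) + 2) - 0 = 4 * l + 8 := by omega
  have e₅ : 2 * (l + 1) + 1 = 2 * l + 3 := by omega
  have e₆ : 2 * (l + 1) + 2 = 2 * l + 4 := by omega
  rw [mixedPadeCoeff, expPadeCoeff, expPadeCoeff, e₃, e₄, e₁, e₂, e₅, e₆,
    Nat.cast_choose ℚ (show 2 * l + 3 ≤ 4 * l + 6 by omega),
    Nat.cast_choose ℚ (show 2 * l + 4 ≤ 4 * l + 8 by omega),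
    show 4 * l + 6 - (2 * l + 3) = 2 * l + 3 by omega,
    show 4 * l + 8 - (2 * l + 4) = 2 * l + 4 by omega]
  simp only [Nat.factorial_succ (2 * l + 3), Nat.factorial_succ (2 * l + 2),
    Nat.factorial_succ (2 * l + 1), Nat.factorial_succ (4 * l + 7),
    Nat.factorial_succ (4 * l + 6), Nat.factorial_zero]
  push_cast
  field_simp
  ring

theorem sum_neg_one_pow_mul_mixedPadeCoeff {n N : ℕ} (hN : N ≤ 4 * n + 2) :
    ∑ k ∈ Finset.range (N + 1), (-1 : ℚ) ^ k * mixedPadeCoeff n k * (1 / (N - k)!) =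
      mixedPadeCoeff n N := by
  rw [mixedPadeCoeff, ← sum_neg_one_pow_mul_expPadeCoeff (show N ≤ 2 * (2 * n + 1) by omega),
    ← sum_neg_one_pow_mul_expPadeCoeff (show N ≤ 2 * (2 * n + 2) by omega), Finset.mul_sum,
    ← Finset.sum_sub_distrib]
  refine Finset.sum_congr rfl fun k _ => ?_
  rw [mixedPadeCoeff]
  ring

/-- The even part of the mixed Padé numerator. -/
def evenMixedPadeCoeff (n k : ℕ) : ℚ := if Even k then mixedPadeCoeff n k else 0

theorem coeff_eulerSeriesOne_mul_even {n N : ℕ} (hN : N ≤ 4 * n + 2) :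
    PowerSeries.coeff N (PowerSeries.mk (evenMixedPadeCoeff n) * eulerSeriesOne) =
      mixedPadeCoeff n N := by
  set e := PowerSeries.exp ℚ
  set P := PowerSeries.mk (evenMixedPadeCoeff n)
  set A := PowerSeries.mk fun k => (-1 : ℚ) ^ k * mixedPadeCoeff n k
  set B := PowerSeries.mk (mixedPadeCoeff n)
  have hP : 2 * P = A + B := by
    ext k
    rw [two_mul]
    simp only [P, A, B, map_add, PowerSeries.coeff_mk, evenMixedPadeCoeff]
    split_ifs with h
    · rw [h.neg_one_pow, one_mul]
    · rw [(Nat.not_even_iff_odd.mp h).neg_one_pow]; ring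
  -- Since 2P = A + B, this defect is exactly the Padé defect of B.
  have hmul : (e + 1) * (P * eulerSeriesOne - B) = A * e - B := by
    linear_combination P * eulerSeriesOne_mul_exp_add_one + e * hP
  have hdvd : PowerSeries.X ^ (4 * n + 3) ∣ A * e - B := by
    rw [PowerSeries.X_pow_dvd_iff]
    intro K hK
    rw [map_sub, PowerSeries.coeff_mul, Finset.Nat.sum_antidiagonal_eq_sum_range_succ_mk,
      sub_eq_zero]
    simpa [A, B, e, PowerSeries.coeff_exp] using
      sum_neg_one_pow_mul_mixedPadeCoeff (show K ≤ 4 * n + 2 by omega)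
  have hfactor : P * eulerSeriesOne - B = (A * e - B) * (e + 1)⁻¹ := by
    rw [← hmul, mul_right_comm, PowerSeries.mul_inv_cancel _ constantCoeff_exp_add_one_ne_zero,
      one_mul]
  have hzero := PowerSeries.X_pow_dvd_iff.mp (hfactor ▸ hdvd.mul_right (e + 1)⁻¹) N (by omega)
  rw [map_sub, sub_eq_zero] at hzero
  rw [hzero, PowerSeries.coeff_mk]

theorem sum_mixedPadeCoeff_mul_coeff_eulerSeriesOne {n N : ℕ} (hN : 2 * N + 1 ≤ 4 * n + 2) :
    ∑ j ∈ Finset.range (N + 1), mixedPadeCoeff n (2 * j) *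
      PowerSeries.coeff (2 * (N - j) + 1) eulerSeriesOne = mixedPadeCoeff n (2 * N + 1) := by
  rw [← coeff_eulerSeriesOne_mul_even hN, PowerSeries.coeff_mul,
    Finset.Nat.sum_antidiagonal_eq_sum_range_succ_mk]
  refine Finset.sum_of_injOn (fun j => 2 * j) (fun a _ b _ h => by simpa using h) ?_ ?_ ?_
  · intro j hj
    simp only [Finset.coe_range, Set.mem_Iio] at hj ⊢
    omega
  -- P is even, so only even k contribute.
  · intro k hk hk'
    rw [PowerSeries.coeff_mk, evenMixedPadeCoeff, if_neg, zero_mul]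
    rintro ⟨j, rfl⟩
    refine hk' ⟨j, ?_, by simp only; omega⟩
    simp only [Finset.coe_range, Set.mem_Iio, Finset.mem_range] at hk ⊢
    omega
  · intro j hj
    rw [Finset.mem_range] at hj
    rw [PowerSeries.coeff_mk, evenMixedPadeCoeff, if_pos (even_two_mul j),
      show 2 * N + 1 - 2 * j = 2 * (N - j) + 1 by omega]

theorem sum_mixedPadeCoeff_mul_hankel {n i : ℕ} (hi : i ≤ n) :
    ∑ j ∈ Finset.range (n + 1), mixedPadeCoeff n (2 * (n - j)) *
      PowerSeries.coeff (2 * (i + j) + 1) eulerSeriesOne =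
      if i = 0 then 0 else PowerSeries.coeff (2 * i - 1) eulerSeriesOne := by
  have hsum := sum_mixedPadeCoeff_mul_coeff_eulerSeriesOne (show 2 * (n + i) + 1 ≤ 4 * n + 2 by omega)
  have hrefl : ∑ j ∈ Finset.range (n + 1), mixedPadeCoeff n (2 * (n - j)) *
      PowerSeries.coeff (2 * (i + j) + 1) eulerSeriesOne =
      ∑ j ∈ Finset.range (n + 1), mixedPadeCoeff n (2 * j) *
        PowerSeries.coeff (2 * (n + i - j) + 1) eulerSeriesOne := by
    rw [← Finset.sum_range_reflect]
    refine Finset.sum_congr rfl fun j hj => ?_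
    rw [Finset.mem_range] at hj
    rw [show n - (n + 1 - 1 - j) = j by omega, show i + (n + 1 - 1 - j) = n + i - j by omega]
  rw [hrefl]
  rcases i with _ | i
  · rw [if_pos rfl, hsum, show n + 0 = n from rfl, mixedPadeCoeff_two_mul_add_one]
  -- The term j = n+1 has coefficient -1; moved across, it is the required entry. Later terms
  -- vanish.
  · rw [mixedPadeCoeff_of_lt (by omega), show n + (i + 1) + 1 = (n + 1 + 1) + i by ring,
      Finset.sum_range_add, Finset.sum_range_succ _ (n + 1),
      show 2 * (n + 1) = 2 * n + 2 by ring, mixedPadeCoeff_two_mul_add_two,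
      Finset.sum_eq_zero (s := Finset.range i) fun j _ => by
        rw [mixedPadeCoeff_of_lt (by omega), zero_mul],
      show 2 * (n + (i + 1) - (n + 1)) + 1 = 2 * (i + 1) - 1 by omega] at hsum
    rw [if_neg (Nat.succ_ne_zero i)]
    linear_combination hsum

/-- If prepending `b 0` to a sequence `c` gives `b`, and the first column of the Hankel matrix of
`b` is the image of `w` under that of `c`, then the two Hankel determinants differ by the factor
`(-1) ^ n * w n`. -/
theorem hankelDet_of_mulVec {R : Type*} [CommRing R] (n : ℕ) (b c w : ℕ → R)
    (hbc : ∀ k, b (k + 1) = c k)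
    (hw : ∀ i ≤ n, ∑ j ∈ Finset.range (n + 1), w j * c (i + j) = b i) :
    hankelDet n b = (-1) ^ n * w n * hankelDet n c := by
  set B : Matrix (Fin (n + 1)) (Fin (n + 1)) R := Matrix.of fun i j => b (i + j)
  set C : Matrix (Fin (n + 1)) (Fin (n + 1)) R := Matrix.of fun i j => c (i + j)
  have hrotate : B.submatrix id (finRotate (n + 1)) =
      C.updateCol (Fin.last n) fun i => ∑ j : Fin (n + 1), w j • C i j := by
    ext i j
    rcases eq_or_ne j (Fin.last n) with rfl | hj
    · rw [Matrix.submatrix_apply, finRotate_last, Matrix.updateCol_self]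
      simp only [id, B, C, Matrix.of_apply, Fin.val_zero, add_zero, smul_eq_mul]
      rw [← hw i (Nat.lt_succ_iff.mp i.isLt),
        Finset.sum_range fun j => w j * c ((i : ℕ) + j)]
    · rw [Matrix.submatrix_apply, Matrix.updateCol_ne hj]
      simp only [id, B, C, Matrix.of_apply, coe_finRotate_of_ne_last hj]
      rw [← add_assoc, hbc]
  have hdet := congrArg Matrix.det hrotate
  -- An (n+1)-cycle has sign (-1)^n.
  rw [Matrix.det_permute', Matrix.det_updateCol_sum, sign_finRotate, Nat.add_sub_cancel,
    Fin.val_last, smul_eq_mul] at hdet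
  push_cast at hdet
  have hsign : ((-1 : R) ^ n) * (-1) ^ n = 1 := by rw [← mul_pow]; simp
  change B.det = (-1) ^ n * w n * C.det
  rw [mul_assoc, ← hdet, ← mul_assoc, hsign, one_mul]

theorem proposition6p3 (b : ℕ → ℚ) (hb_zero : b 0 = 0)
    (hb : ∀ k : ℕ, 1 ≤ k → b k = (eulerPolynomial (2 * k - 1)).eval 1 / ((2 * k - 1)! : ℚ))
    (n : ℕ) (hn : 1 ≤ n) :
    hankelDet n b = (-1 : ℚ) ^ n * (((4 * n + 2)! : ℚ) / ((2 * n - 1)! : ℚ)) *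
      hankelDet n (fun k => (eulerPolynomial (2 * k + 1)).eval 1 / ((2 * k + 1)! : ℚ)) := by
  have hb_succ : ∀ k, b (k + 1) =
      (eulerPolynomial (2 * k + 1)).eval 1 / ((2 * k + 1)! : ℚ) := fun k => by
    rw [hb (k + 1) (by omega), show 2 * (k + 1) - 1 = 2 * k + 1 by omega]
  rw [hankelDet_of_mulVec n b _ (fun j => mixedPadeCoeff n (2 * (n - j))) hb_succ, Nat.sub_self,
    mul_zero, mixedPadeCoeff_zero hn]
  intro i hi
  simp only [eval_one_eulerPolynomial_div_factorial]
  rw [sum_mixedPadeCoeff_mul_hankel hi]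
  split_ifs with h
  · rw [h, hb_zero]
  · rw [hb i (by omega), eval_one_eulerPolynomial_div_factorial]
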